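/- Let $\tau\in\mathbb{C}$ with $\Im(\tau)>0$. Let $H_3(\mathbb{R})=\mathbb{C}\times\mathbb{R}$ be the Heisenberg group with product $(z_1,t_1)\cdot(z_2,t_2)=(z_1+z_2,\,t_1+t_2+\Im(\bar z_1z_2))$, let $H_3(\mathbb{Z})$ be the subgroup generated by $(1,0)$ and $(\tau,0)$, and let $A=C^\infty(M_3)$ be the algebra of smooth complex-valued functions on $M_3=H_3(\mathbb{R})/H_3(\mathbb{Z})$, i.e. of smooth functions of $(z,t)$ on $H_3(\mathbb{R})$ that are invariant under right translation by $H_3(\mathbb{Z})$. Put $$\mathfrak{q}=\sqrt{\tfrac{\Im(\tau)}{\pi}}\Big(\frac{\partial}{\partial\bar z}-\frac{iz}{2}\frac{\partial}{\partial t}\Big),\qquad \mathfrak{t}=\frac{\Im(\tau)}{\pi i}\frac{\partial}{\partial t},$$ $A_{\mathrm{hol}}=\{f\in A:\mathfrak{q}f=0\}$ and, for $n\in\mathbb{Z}$, $A_n=\{f\in A:\mathfrak{t}f=nf\}$. If $n<0$, then $A_{\mathrm{hol}}\cap A_n=\{0\}$. If $n>0$, the elements $f\in A_{\mathrm{hol}}\cap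 A_n$ are in bijection with the elements $c_f\in\mathbb{C}^{\mathbb{Z}/n\mathbb{Z}}$ via the formula $$f(z,t)=e^{\pi in\left(\frac{t}{\Im(\tau)}+xy+\tau y^2\right)}\sum_{k\in\mathbb{Z}}c_f(k)\,q^{k^2/n}e^{2\pi ikz},\qquad z=x+\tau y,\quad x,y,t\in\mathbb{R},$$ where $q^{s}:=e^{\pi i\tau s}$ for real $s$, and the series converges absolutely for every $z$. -/

import Mathlib

open scoped ContDiff

/-- The real Heisenberg group `H₃(ℝ) = ℂ × ℝ`. -/
@[ext]
structure H3 where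
  z : ℂ
  t : ℝ

namespace H3

/-- `(z₁,t₁)·(z₂,t₂) = (z₁ + z₂, t₁ + t₂ + Im(z̄₁ z₂))`. -/
instance : Mul H3 :=
  ⟨fun g h => ⟨g.z + h.z, g.t + h.t + (starRingEnd ℂ g.z * h.z).im⟩⟩

instance : One H3 := ⟨⟨0, 0⟩⟩

instance : Inv H3 := ⟨fun g => ⟨-g.z, -g.t⟩⟩

theorem mul_def (g h : H3) :
    g * h = ⟨g.z + h.z, g.t + h.t + (starRingEnd ℂ g.z * h.z).im⟩ := rfl

theorem one_def : (1 : H3) = ⟨0, 0⟩ := rfl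

theorem inv_def (g : H3) : g⁻¹ = ⟨-g.z, -g.t⟩ := rfl

instance : Group H3 :=
  Group.ofLeftAxioms
    (by
      intro a b c
      ext <;> simp [mul_def] <;> ring)
    (by
      intro a
      ext <;> simp [mul_def, one_def])
    (by
      intro a
      ext <;> simp [mul_def, one_def, inv_def] <;> ring)

/-- `H₃(ℤ)`: the subgroup generated by `(1,0)` and `(τ,0)`. -/
def intSubgroup (τ : ℂ) : Subgroup H3 := Subgroup.closure {⟨1, 0⟩, ⟨τ, 0⟩}

end H3

/-- The Heisenberg manifold `M₃ = H₃(ℝ)/H₃(ℤ)`, the space of left cosets `g H₃(ℤ)`. -/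
abbrev M3 (τ : ℂ) : Type := H3 ⧸ H3.intSubgroup τ

namespace M3

/-- The class in `M₃` of the element `(z,t)` of `H₃(ℝ)`. -/
def proj (τ : ℂ) (p : ℂ × ℝ) : M3 τ := QuotientGroup.mk (H3.mk p.1 p.2)

/-- A function on `M₃`, seen as a right `H₃(ℤ)`-invariant function of `(z,t) ∈ ℂ × ℝ = H₃(ℝ)`. -/
def pullback (τ : ℂ) (f : M3 τ → ℂ) : ℂ × ℝ → ℂ := fun p => f (proj τ p)

/-- `A = C^∞(M₃)`. As `H₃(ℝ) → M₃` is a covering map, a function on `M₃` is smooth if and only if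
its pullback to `H₃(ℝ) = ℂ × ℝ` is smooth (in the real sense). -/
def smooth (τ : ℂ) : Set (M3 τ → ℂ) := {f | ContDiff ℝ ∞ (pullback τ f)}

end M3

namespace Heis

/-- The real partial derivative `∂F/∂t` of a function of `(z,t)`. -/
noncomputable def dt (F : ℂ × ℝ → ℂ) (p : ℂ × ℝ) : ℂ := fderiv ℝ F p (0, 1)

/-- The Wirtinger derivative `∂F/∂z̄ = (∂F/∂u + i ∂F/∂v)/2`, where `z = u + iv`. -/
noncomputable def dzbar (F : ℂ × ℝ → ℂ) (p : ℂ × ℝ) : ℂ :=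
  (fderiv ℝ F p (1, 0) + Complex.I * fderiv ℝ F p (Complex.I, 0)) / 2

/-- The vector field `𝔮 = √(Im τ / π) (∂/∂z̄ - (i z / 2) ∂/∂t)`. -/
noncomputable def q (τ : ℂ) (F : ℂ × ℝ → ℂ) (p : ℂ × ℝ) : ℂ :=
  (Real.sqrt (τ.im / Real.pi) : ℂ) * (dzbar F p - Complex.I * p.1 / 2 * dt F p)

/-- The central vector field `𝔱 = (Im τ / (π i)) ∂/∂t`. -/
noncomputable def t (τ : ℂ) (F : ℂ × ℝ → ℂ) (p : ℂ × ℝ) : ℂ :=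
  (τ.im : ℂ) / (Real.pi * Complex.I) * dt F p

end Heis

namespace M3

/-- `A_hol`: the kernel of `𝔮` on `A`. -/
def hol (τ : ℂ) : Set (M3 τ → ℂ) :=
  {f | f ∈ smooth τ ∧ ∀ p, Heis.q τ (pullback τ f) p = 0}

/-- `A_n = {f ∈ A : 𝔱 f = n f}`. -/
def weight (τ : ℂ) (n : ℤ) : Set (M3 τ → ℂ) :=
  {f | f ∈ smooth τ ∧ ∀ p, Heis.t τ (pullback τ f) p = n * pullback τ f p}

end M3

/-- The general term `c(k) q^{k²/n} e^{2πikz}` of the theta series, where `q = e^{πiτ}` and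
`q^s` means `e^{πiτs}`. -/
noncomputable def thetaTerm (τ : ℂ) (n : ℕ) (c : ZMod n → ℂ) (z : ℂ) (k : ℤ) : ℂ :=
  c (k : ZMod n) * Complex.exp (Real.pi * Complex.I * τ * ((k : ℂ) ^ 2 / (n : ℂ))) *
    Complex.exp (2 * Real.pi * Complex.I * k * z)

/-!
Let `φ(z,t) = πin (t + z Im z) / Im τ`, the exponent in the formula. It satisfies `∂φ/∂t = πin / Im τ`
and `∂φ/∂z̄ = (iz/2) ∂φ/∂t`, so a smooth function written as `f = e^φ Θ` satisfies `𝔱f = nf` and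
`𝔮f = 0` exactly when `∂Θ/∂t = 0` and `∂Θ/∂z̄ = 0`, that is, when `Θ(z,t) = θ(z)` with `θ` entire.
Invariance of `f` under the two generators of `H₃(ℤ)` becomes `θ(z+1) = θ(z)` and
`θ(z+τ) = e^{-πin(2z+τ)} θ(z)` (`IsTheta`). Hence `A_hol ∩ A_n` is the space of theta functions of
degree `n`, by `exists_isTheta` and `IsTheta.exists_mem`.

An entire `1`-periodic `θ` has Laurent coefficients `a_k` in `e^{2πiz}`, given by the integral of
`θ(z) e^{-2πikz}` over any horizontal period (`laurentCoeff_shift`). Moving the line of integration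
by `τ` yields `a_{k+n} = e^{πinτ} e^{2πikτ} a_k`, which says that `a_k / q^{k²/n}` depends only on `k`
modulo `n`. For `n < 0` the numbers `|q^{k²/n}|` blow up along each residue class while the `a_k` stay
bounded, so all `a_k` vanish (`IsTheta.eq_zero_of_neg`). For `n > 0` they decay like a Gaussian, the
Laurent series converges absolutely to `θ` (`IsTheta.exists_eq_thetaSeries`), and conversely every
`c : ZMod n → ℂ` gives a theta function (`isTheta_thetaSeries`) that determines `c`
(`thetaSeries_injective`).
-/

namespace HeisTheta

open Complex Real

/-! ### Laurent coefficients of entire `1`-periodic functions -/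

/-- The additive character `e(k z) = e^{2πikz}`. -/
noncomputable def char (k : ℤ) (z : ℂ) : ℂ := cexp (2 * π * I * k * z)

theorem differentiable_char (k : ℤ) : Differentiable ℂ (char k) := by
  unfold char; fun_prop

theorem char_add (k : ℤ) (z w : ℂ) : char k (z + w) = char k z * char k w := by
  rw [char, char, char, ← Complex.exp_add]; ring_nf

theorem char_add_index (k l : ℤ) (z : ℂ) : char (k + l) z = char k z * char l z := by
  rw [char, char, char, ← Complex.exp_add]; push_cast; ring_nf

theorem char_neg_mul_char (k : ℤ) (z : ℂ) : char (-k) z * char k z = 1 := by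
  rw [char, char, ← Complex.exp_add, ← Complex.exp_zero]; push_cast; ring_nf

theorem char_one (k : ℤ) : char k 1 = 1 := by
  rw [char, Complex.exp_eq_one_iff]; exact ⟨k, by ring⟩

theorem norm_char (k : ℤ) (z : ℂ) : ‖char k z‖ = rexp (-(2 * π * k * z.im)) := by
  rw [char, Complex.norm_exp]
  congr 1
  simp [mul_assoc]

theorem norm_char_ofReal (k : ℤ) (x : ℝ) : ‖char k x‖ = 1 := by
  simp [norm_char]

/-- The integral of an entire `1`-periodic function over a horizontal period is the same at every
height: with a primitive `G` it equals `G (w + 1) - G w`, whose derivative in `w` vanishes. -/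
theorem integral_period_eq {g : ℂ → ℂ} (hg : Differentiable ℂ g) (hper : ∀ z, g (z + 1) = g z)
    (w : ℂ) : ∫ x in (0 : ℝ)..1, g (x + w) = ∫ x in (0 : ℝ)..1, g x := by
  obtain ⟨G, hG⟩ := hg.isExactOn_univ
  have hG' : ∀ z, HasDerivAt G (g z) z := fun z => hG z (Set.mem_univ z)
  have key : ∀ w : ℂ, ∫ x in (0 : ℝ)..1, g (x + w) = G (w + 1) - G w := by
    intro w
    have h := intervalIntegral.integral_eq_sub_of_hasDerivAt (a := 0) (b := 1)
      (f := fun x : ℝ => G (x + w)) (f' := fun x : ℝ => g (x + w))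
      (fun x _ => (HasDerivAt.comp_add_const (x : ℂ) w (hG' _)).comp_ofReal)
      (Continuous.intervalIntegrable
        (hg.continuous.comp (Complex.continuous_ofReal.add continuous_const)) _ _)
    rw [h]; push_cast; ring_nf
  have hd : ∀ w : ℂ, HasDerivAt (fun w => G (w + 1) - G w) 0 w := by
    intro w
    have h := (HasDerivAt.comp_add_const w 1 (hG' (w + 1))).sub (hG' w)
    rw [hper, sub_self] at h
    exact h
  have hc := is_const_of_deriv_eq_zero (fun w => (hd w).differentiableAt) (fun w => (hd w).deriv) w 0
  simpa [key] using hc.trans (by simpa using (key 0).symm)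

/-- The `k`-th Laurent coefficient, in the variable `e^{2πiz}`, of a `1`-periodic function. -/
noncomputable def laurentCoeff (θ : ℂ → ℂ) (k : ℤ) : ℂ := ∫ x in (0 : ℝ)..1, char (-k) x * θ x

theorem laurentCoeff_shift {θ : ℂ → ℂ} (hθ : Differentiable ℂ θ) (hper : ∀ z, θ (z + 1) = θ z)
    (k : ℤ) (w : ℂ) :
    ∫ x in (0 : ℝ)..1, char (-k) x * θ (x + w) = laurentCoeff θ k * char k w := by
  have h := integral_period_eq (g := fun z => char (-k) z * θ z) ((differentiable_char _).mul hθ)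
    (fun z => by simp [char_add, char_one, hper]) w
  rw [laurentCoeff, ← h, ← intervalIntegral.integral_mul_const]
  refine intervalIntegral.integral_congr fun x _ => ?_
  simp only [char_add]
  linear_combination (-char (-k) x * θ (x + w)) * char_neg_mul_char k w

/-- Laurent expansion: on each horizontal line this is the pointwise convergence of an absolutely
convergent Fourier series. -/
theorem hasSum_laurent {θ : ℂ → ℂ} (hθ : Differentiable ℂ θ) (hper : ∀ z, θ (z + 1) = θ z)
    (w : ℂ) (hs : Summable fun k => laurentCoeff θ k * char k w) :
    HasSum (fun k => laurentCoeff θ k * char k w) (θ w) := by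
  have hp : Function.Periodic (fun x : ℝ => θ (x + w)) 1 := fun x => by
    have := hper (x + w)
    simp only [← this]; push_cast; ring_nf
  have hcont : Continuous (fun x : ℝ => θ (x + w)) :=
    hθ.continuous.comp (Complex.continuous_ofReal.add continuous_const)
  let F : C(AddCircle (1 : ℝ), ℂ) := ⟨hp.lift, continuous_coinduced_dom.mpr hcont⟩
  have hF : ∀ x : ℝ, F x = θ (x + w) := fun x => hp.lift_coe x
  have hcoeff : ∀ k, fourierCoeff F k = laurentCoeff θ k * char k w := by
    intro k
    rw [fourierCoeff_eq_intervalIntegral _ _ 0, ← laurentCoeff_shift hθ hper]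
    simp only [one_div, inv_one, one_smul, zero_add]
    refine intervalIntegral.integral_congr fun x _ => ?_
    simp [hF, char, fourier_coe_apply, -fourier_apply]
  have h := has_pointwise_sum_fourier_series_of_summable (f := F)
    (by simpa only [← hcoeff] using hs) ((0 : ℝ) : AddCircle (1 : ℝ))
  rw [hF] at h
  simpa [hcoeff] using h

/-- An absolutely convergent Fourier series determines its coefficients. -/
theorem eq_zero_of_hasSum_char {a : ℤ → ℂ} (ha : Summable a)
    (h : ∀ x : ℝ, HasSum (fun k => a k * char k x) 0) : a = 0 := by
  have hs : Summable fun k => a k • (fourier k : C(AddCircle (1 : ℝ), ℂ)) :=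
    Summable.of_norm (by simpa only [norm_smul, fourier_norm, mul_one] using ha.norm)
  have h0 : ∑' k, a k • (fourier k : C(AddCircle (1 : ℝ), ℂ)) = 0 := by
    ext y
    induction y using QuotientAddGroup.induction_on with | H x =>
    have h1 := (ContinuousMap.evalCLM ℂ (x : AddCircle (1 : ℝ))).hasSum hs.hasSum
    refine HasSum.unique h1 ?_
    convert! h x using 2 with k
    simp [char, fourier_coe_apply, -fourier_apply]
  have h2 := (ContinuousMap.toLp (E := ℂ) 2 AddCircle.haarAddCircle ℂ).hasSum hs.hasSum
  funext m
  have h3 := (innerSL ℂ (fourierLp (T := (1 : ℝ)) 2 m)).hasSum h2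
  rw [h0, map_zero, map_zero] at h3
  have ho := orthonormal_iff_ite.mp (orthonormal_fourier (T := (1 : ℝ)))
  refine HasSum.unique ?_ h3
  convert! hasSum_ite_eq m (a m) using 2 with k
  have hk := ho m k
  rw [fourierLp, fourierLp] at hk
  rw [map_smul, map_smul, innerSL_apply_apply, fourierLp, hk]
  by_cases hkm : m = k
  · simp [hkm]
  · simp [hkm, Ne.symm hkm]

/-! ### Theta functions -/

/-- Theta functions of degree `n` for the lattice `ℤ + ℤτ`: entire functions that are `1`-periodic
and acquire the automorphy factor `e^{-πin(2z+τ)}` under translation by `τ`. -/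
structure IsTheta (τ : ℂ) (n : ℤ) (θ : ℂ → ℂ) : Prop where
  differentiable : Differentiable ℂ θ
  add_one : ∀ z, θ (z + 1) = θ z
  add_tau : ∀ z, θ (z + τ) = cexp (-(π * I * n * (2 * z + τ))) * θ z

/-- The coefficient `q^{k²/n}`, where `q = e^{πiτ}`. -/
noncomputable def qPow (τ : ℂ) (n k : ℤ) : ℂ := cexp (π * I * τ * ((k : ℂ) ^ 2 / (n : ℂ)))

theorem qPow_ne_zero (τ : ℂ) (n k : ℤ) : qPow τ n k ≠ 0 := Complex.exp_ne_zero _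

theorem qPow_add {τ : ℂ} {n : ℤ} (hn : n ≠ 0) (k : ℤ) :
    qPow τ n (k + n) = cexp (π * I * n * τ) * char k τ * qPow τ n k := by
  have : (n : ℂ) ≠ 0 := by exact_mod_cast hn
  rw [qPow, qPow, char, ← Complex.exp_add, ← Complex.exp_add]
  congr 1
  push_cast
  field_simp
  ring

theorem norm_qPow (τ : ℂ) (n k : ℤ) : ‖qPow τ n k‖ = rexp (-(π * τ.im * (k : ℝ) ^ 2 / n)) := by
  have h : (π * I * τ * ((k : ℂ) ^ 2 / (n : ℂ))) = ((π * ((k : ℝ) ^ 2 / n) : ℝ) : ℂ) * (τ * I) := by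
    push_cast; ring
  rw [qPow, Complex.norm_exp, h, Complex.re_ofReal_mul, Complex.mul_I_re]
  ring_nf

/-- Translation by `τ` gives a recursion of step `n` for the Laurent coefficients. -/
theorem IsTheta.laurentCoeff_add {τ : ℂ} {n : ℤ} {θ : ℂ → ℂ} (h : IsTheta τ n θ) (k : ℤ) :
    laurentCoeff θ (k + n) = cexp (π * I * n * τ) * char k τ * laurentCoeff θ k := by
  have h1 := laurentCoeff_shift h.differentiable h.add_one k τ
  have h2 : ∫ x in (0 : ℝ)..1, char (-k) x * θ (x + τ) =
      cexp (-(π * I * n * τ)) * laurentCoeff θ (k + n) := by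
    rw [laurentCoeff, ← intervalIntegral.integral_const_mul]
    refine intervalIntegral.integral_congr fun x _ => ?_
    have h3 : cexp (-(π * I * n * (2 * x + τ))) = cexp (-(π * I * n * τ)) * char (-n) x := by
      rw [char, ← Complex.exp_add]; push_cast; ring_nf
    simp only [h.add_tau, h3, neg_add, char_add_index]
    ring
  rw [h2] at h1
  have h4 : cexp (π * I * n * τ) * cexp (-(π * I * n * τ)) = 1 := by
    rw [← Complex.exp_add, add_neg_cancel, Complex.exp_zero]
  linear_combination cexp (π * I * n * τ) * h1 - laurentCoeff θ (k + n) * h4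

/-- The Laurent coefficients are `q^{k²/n}` times a function that only depends on `k` modulo `n`. -/
theorem IsTheta.laurentCoeff_div_qPow_periodic {τ : ℂ} {n : ℤ} (hn : n ≠ 0) {θ : ℂ → ℂ}
    (h : IsTheta τ n θ) : Function.Periodic (fun k => laurentCoeff θ k / qPow τ n k) n := by
  intro k
  have h1 : cexp (π * I * n * τ) * char k τ ≠ 0 :=
    mul_ne_zero (Complex.exp_ne_zero _) (Complex.exp_ne_zero _)
  simp only [h.laurentCoeff_add, qPow_add hn, mul_div_mul_left _ _ h1]

theorem exists_norm_laurentCoeff_le {θ : ℂ → ℂ} (hθ : Continuous θ) :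
    ∃ C, ∀ k, ‖laurentCoeff θ k‖ ≤ C := by
  obtain ⟨C, hC⟩ := (isCompact_uIcc (a := (0 : ℝ)) (b := 1)).exists_bound_of_continuousOn
    (hθ.comp Complex.continuous_ofReal).continuousOn
  refine ⟨C * |1 - 0|, fun k => intervalIntegral.norm_integral_le_of_norm_le_const fun x hx => ?_⟩
  rw [norm_mul, norm_char_ofReal, one_mul]
  exact hC x (Set.uIoc_subset_uIcc hx)

/-- In negative degree `|q^{k²/n}|` tends to infinity along each residue class, while Laurent
coefficients are bounded; so they all vanish. -/
theorem IsTheta.eq_zero_of_neg {τ : ℂ} (hτ : 0 < τ.im) {n : ℤ} (hn : n < 0) {θ : ℂ → ℂ}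
    (h : IsTheta τ n θ) : θ = 0 := by
  have hcoeff : ∀ k, laurentCoeff θ k = 0 := by
    intro k
    obtain ⟨C, hC⟩ := exists_norm_laurentCoeff_le h.differentiable.continuous
    by_contra hk
    set r : ℝ := ‖laurentCoeff θ k / qPow τ n k‖ with hr
    have hr0 : 0 < r := norm_pos_iff.mpr (div_ne_zero hk (qPow_ne_zero _ _ _))
    have hlim : Filter.Tendsto (fun m : ℕ => ((k + m * n : ℤ) : ℝ) ^ 2)
        Filter.atTop Filter.atTop := by
      have h1 : Filter.Tendsto (fun m : ℕ => (k : ℝ) + m * n) Filter.atTop Filter.atBot :=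
        Filter.tendsto_atBot_add_const_left _ _
          (tendsto_natCast_atTop_atTop.atTop_mul_const_of_neg (by exact_mod_cast hn))
      convert (Filter.tendsto_pow_atTop two_ne_zero).comp (Filter.tendsto_neg_atBot_atTop.comp h1)
        using 2 with m
      simp; ring
    have hn' : (0 : ℝ) < -(n : ℝ) := by simpa using hn
    have hq : Filter.Tendsto (fun m : ℕ => ‖qPow τ n (k + m * n)‖) Filter.atTop Filter.atTop := by
      have h2 := Real.tendsto_exp_atTop.comp
        (hlim.const_mul_atTop (r := π * τ.im / (-(n : ℝ))) (by positivity))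
      refine h2.congr fun m => ?_
      rw [norm_qPow, Function.comp_apply]
      congr 1
      field_simp
    obtain ⟨m, hm⟩ := (hq.eventually_gt_atTop (C / r)).exists
    have hper := (h.laurentCoeff_div_qPow_periodic hn.ne).nat_mul m k
    have hper' : ‖laurentCoeff θ (k + m * n)‖ = r * ‖qPow τ n (k + m * n)‖ := by
      rw [hr, ← hper, ← norm_mul]
      exact congrArg _ (div_mul_cancel₀ _ (qPow_ne_zero _ _ _)).symm
    rw [div_lt_iff₀ hr0, mul_comm, ← hper'] at hm
    exact absurd (hC _) (not_le.mpr hm)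
  funext w
  refine (hasSum_laurent h.differentiable h.add_one w ?_).unique ?_ <;> simp [hcoeff, summable_zero,
    hasSum_zero]

/-! ### Theta series -/

theorem thetaTerm_eq_jacobi (τ : ℂ) (n : ℕ) (c : ZMod n → ℂ) (z : ℂ) (k : ℤ) :
    thetaTerm τ n c z k = c k * jacobiTheta₂_term k z (τ / n) := by
  rw [thetaTerm, jacobiTheta₂_term, mul_assoc, ← Complex.exp_add]
  ring_nf

theorem thetaTerm_eq_char (τ : ℂ) (n : ℕ) (c : ZMod n → ℂ) (z : ℂ) (k : ℤ) :
    thetaTerm τ n c z k = c k * qPow τ n k * char k z := by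
  simp [thetaTerm, qPow, char]

/-- The theta series `∑ c(k) q^{k²/n} e^{2πikz}`. -/
noncomputable def thetaSeries (τ : ℂ) (n : ℕ) (c : ZMod n → ℂ) (z : ℂ) : ℂ :=
  ∑' k : ℤ, thetaTerm τ n c z k

theorem im_div_natCast_pos {τ : ℂ} (hτ : 0 < τ.im) {n : ℕ} (hn : 0 < n) : 0 < (τ / n).im := by
  rw [Complex.div_natCast_im]; positivity

theorem exists_norm_thetaTerm_le (τ : ℂ) {n : ℕ} (hn : 0 < n) (c : ZMod n → ℂ) :
    ∃ C, ∀ z k, ‖thetaTerm τ n c z k‖ ≤ C * ‖jacobiTheta₂_term k z (τ / n)‖ := by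
  have : NeZero n := ⟨hn.ne'⟩
  refine ⟨∑ j, ‖c j‖, fun z k => ?_⟩
  rw [thetaTerm_eq_jacobi, norm_mul]
  gcongr
  exact Finset.single_le_sum (f := fun j => ‖c j‖) (fun _ _ => norm_nonneg _) (Finset.mem_univ _)

theorem summable_thetaTerm {τ : ℂ} (hτ : 0 < τ.im) {n : ℕ} (hn : 0 < n) (c : ZMod n → ℂ) (z : ℂ) :
    Summable (thetaTerm τ n c z) := by
  obtain ⟨C, hC⟩ := exists_norm_thetaTerm_le τ hn c
  exact ((((summable_jacobiTheta₂_term_iff z _).mpr (im_div_natCast_pos hτ hn)).norm).mul_left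
    C).of_norm_bounded (hC z)

theorem hasSum_thetaSeries {τ : ℂ} (hτ : 0 < τ.im) {n : ℕ} (hn : 0 < n) (c : ZMod n → ℂ) (z : ℂ) :
    HasSum (thetaTerm τ n c z) (thetaSeries τ n c z) :=
  (summable_thetaTerm hτ hn c z).hasSum

theorem differentiable_thetaSeries {τ : ℂ} (hτ : 0 < τ.im) {n : ℕ} (hn : 0 < n)
    (c : ZMod n → ℂ) : Differentiable ℂ (thetaSeries τ n c) := by
  intro z
  obtain ⟨C, hC⟩ := exists_norm_thetaTerm_le τ hn c
  have hC0 : 0 ≤ C := nonneg_of_mul_nonneg_left ((norm_nonneg _).trans (hC 0 0))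
    (norm_pos_iff.mpr (Complex.exp_ne_zero _))
  have hT := im_div_natCast_pos hτ hn
  -- on the horizontal strip `|Im w| < |Im z| + 1` the series converges uniformly
  have hU : IsOpen {w : ℂ | |w.im| < |z.im| + 1} :=
    isOpen_lt (by fun_prop) continuous_const
  have hsum := ((summable_pow_mul_jacobiTheta₂_term_bound (|z.im| + 1) hT 0).mul_left C)
  refine (Complex.differentiableOn_tsum_of_summable_norm hsum (F := fun k w => thetaTerm τ n c w k)
    (fun k => ?_) hU fun k w hw => ?_).differentiableAt (hU.mem_nhds (by simp))
  · refine Differentiable.differentiableOn ?_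
    unfold thetaTerm
    fun_prop
  · refine (hC w k).trans ?_
    rw [pow_zero, one_mul]
    gcongr
    exact norm_jacobiTheta₂_term_le hT (le_of_lt hw) le_rfl k

theorem isTheta_thetaSeries {τ : ℂ} (hτ : 0 < τ.im) {n : ℕ} (hn : 0 < n) (c : ZMod n → ℂ) :
    IsTheta τ n (thetaSeries τ n c) where
  differentiable := differentiable_thetaSeries hτ hn c
  add_one z := by
    simp only [thetaSeries, thetaTerm_eq_char, char_add, char_one, mul_one]
  add_tau z := by
    -- the `k`-th term at `z + τ` is the automorphy factor times the `(k + n)`-th term at `z`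
    rw [thetaSeries, thetaSeries, ← (Equiv.addRight (n : ℤ)).tsum_eq (thetaTerm τ n c z),
      ← tsum_mul_left]
    refine tsum_congr fun k => ?_
    have hn' : (n : ℤ) ≠ 0 := by exact_mod_cast hn.ne'
    have h1 : cexp (-(π * I * (n : ℤ) * (2 * z + τ))) *
        (cexp (π * I * (n : ℤ) * τ) * char n z) = 1 := by
      rw [char, ← Complex.exp_add, ← Complex.exp_add, ← Complex.exp_zero]
      ring_nf
    simp only [Equiv.coe_addRight, thetaTerm_eq_char, qPow_add hn', char_add, char_add_index,
      Int.cast_add, Int.cast_natCast, CharP.cast_eq_zero, add_zero] at h1 ⊢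
    linear_combination (-(c k * qPow τ n k * char k z * char k τ)) * h1

/-- In positive degree every theta function is a theta series. -/
theorem IsTheta.exists_eq_thetaSeries {τ : ℂ} (hτ : 0 < τ.im) {n : ℕ} (hn : 0 < n) {θ : ℂ → ℂ}
    (h : IsTheta τ n θ) : ∃ c, θ = thetaSeries τ n c := by
  have hn' : (n : ℤ) ≠ 0 := by exact_mod_cast hn.ne'
  let c : ZMod n → ℂ := fun j => laurentCoeff θ (j.cast : ℤ) / qPow τ n (j.cast : ℤ)
  have hc : ∀ k : ℤ, c k * qPow τ n k = laurentCoeff θ k := by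
    intro k
    have h1 : c k = laurentCoeff θ k / qPow τ n k := by
      have h2 := (h.laurentCoeff_div_qPow_periodic hn').int_mul (k / n) (k % n)
      simp only [c, ZMod.coe_intCast]
      rw [← h2]
      simp only [Int.cast_id, mul_comm (k / n), Int.emod_add_mul_ediv]
    rw [h1, div_mul_cancel₀ _ (qPow_ne_zero _ _ _)]
  refine ⟨c, funext fun z => ?_⟩
  have hs := hasSum_thetaSeries hτ hn c z
  simp only [funext (thetaTerm_eq_char τ n c z), hc] at hs
  exact (hasSum_laurent h.differentiable h.add_one z hs.summable).unique hs

theorem thetaSeries_injective {τ : ℂ} (hτ : 0 < τ.im) {n : ℕ} (hn : 0 < n) :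
    Function.Injective (thetaSeries τ n) := by
  intro c d hcd
  have h0 := eq_zero_of_hasSum_char (a := fun k => (c k - d k) * qPow τ n k) ?_ fun x => ?_
  · funext j
    obtain ⟨k, rfl⟩ := ZMod.intCast_surjective j
    have := congrFun h0 k
    simpa [qPow_ne_zero, sub_eq_zero] using this
  · refine ((summable_thetaTerm hτ hn c 0).sub (summable_thetaTerm hτ hn d 0)).congr fun k => ?_
    simp [thetaTerm_eq_char, char, sub_mul]
  · have h1 := (hasSum_thetaSeries hτ hn c x).sub (hasSum_thetaSeries hτ hn d x)
    rw [hcd, sub_self] at h1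
    refine (congrArg (HasSum · 0) (funext fun k => ?_)).mpr h1
    rw [thetaTerm_eq_char, thetaTerm_eq_char]
    ring

/-! ### The vector fields `𝔮` and `𝔱` after removing the automorphy exponential -/

/-- The exponent `πin(t / Im τ + xy + τy²)`, `z = x + τy`, written with
`xy + τy² = zy = z Im z / Im τ`. -/
noncomputable def weightExp (τ : ℂ) (n : ℤ) (p : ℂ × ℝ) : ℂ :=
  π * I * n / τ.im * (p.2 + p.1 * p.1.im)

theorem contDiff_weightExp (τ : ℂ) (n : ℤ) : ContDiff ℝ ∞ (weightExp τ n) := by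
  have h1 : ContDiff ℝ ∞ (fun p : ℂ × ℝ => (p.2 : ℂ)) := ofRealCLM.contDiff.comp contDiff_snd
  have h2 : ContDiff ℝ ∞ (fun p : ℂ × ℝ => (p.1.im : ℂ)) :=
    (ofRealCLM ∘L imCLM).contDiff.comp contDiff_fst
  exact contDiff_const.mul (h1.add (contDiff_fst.mul h2))

theorem fderiv_weightExp (τ : ℂ) (n : ℤ) (p v : ℂ × ℝ) :
    fderiv ℝ (weightExp τ n) p v =
      π * I * n / τ.im * (v.2 + (p.1 * v.1.im + p.1.im * v.1)) := by
  have h1 : HasFDerivAt (fun p : ℂ × ℝ => (p.2 : ℂ)) (ofRealCLM ∘L .snd ℝ ℂ ℝ) p :=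
    (ofRealCLM ∘L .snd ℝ ℂ ℝ).hasFDerivAt
  have h2 : HasFDerivAt (fun p : ℂ × ℝ => (p.1.im : ℂ)) (ofRealCLM ∘L imCLM ∘L .fst ℝ ℂ ℝ) p :=
    (ofRealCLM ∘L imCLM ∘L .fst ℝ ℂ ℝ).hasFDerivAt
  have h := (h1.add (hasFDerivAt_fst.mul h2)).const_mul (π * I * n / τ.im : ℂ)
  have h' : fderiv ℝ (weightExp τ n) p = _ := h.fderiv
  rw [h']
  simp
  ring

theorem fderiv_exp_weightExp_mul (τ : ℂ) (n : ℤ) {Θ : ℂ × ℝ → ℂ} {p : ℂ × ℝ}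
    (hΘ : DifferentiableAt ℝ Θ p) (v : ℂ × ℝ) :
    fderiv ℝ (fun p => cexp (weightExp τ n p) * Θ p) p v =
      cexp (weightExp τ n p) * (fderiv ℝ (weightExp τ n) p v * Θ p + fderiv ℝ Θ p v) := by
  have hφ := ((contDiff_weightExp τ n).differentiable (by simp) p).hasFDerivAt
  have h : fderiv ℝ (fun p => cexp (weightExp τ n p) * Θ p) p = _ :=
    (hφ.cexp.mul hΘ.hasFDerivAt).fderiv
  rw [h]
  simp
  ring

theorem t_exp_weightExp_mul {τ : ℂ} (hτ : τ.im ≠ 0) (n : ℤ) {Θ : ℂ × ℝ → ℂ} {p : ℂ × ℝ}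
    (hΘ : DifferentiableAt ℝ Θ p) :
    Heis.t τ (fun p => cexp (weightExp τ n p) * Θ p) p =
      n * (cexp (weightExp τ n p) * Θ p) +
        τ.im / (π * I) * (cexp (weightExp τ n p) * Heis.dt Θ p) := by
  rw [Heis.t, Heis.dt, Heis.dt, fderiv_exp_weightExp_mul τ n hΘ, fderiv_weightExp]
  have : (τ.im : ℂ) ≠ 0 := by exact_mod_cast hτ
  have : (π : ℂ) ≠ 0 := by exact_mod_cast pi_ne_zero
  simp
  field_simp

theorem q_exp_weightExp_mul (τ : ℂ) (n : ℤ) {Θ : ℂ × ℝ → ℂ} {p : ℂ × ℝ}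
    (hΘ : DifferentiableAt ℝ Θ p) :
    Heis.q τ (fun p => cexp (weightExp τ n p) * Θ p) p =
      √(τ.im / π) * (cexp (weightExp τ n p) * (Heis.dzbar Θ p - I * p.1 / 2 * Heis.dt Θ p)) := by
  rw [Heis.q, Heis.dt, Heis.dt, Heis.dzbar, Heis.dzbar]
  simp only [fderiv_exp_weightExp_mul τ n hΘ, fderiv_weightExp]
  simp only [one_im, zero_im, I_im, ofReal_zero, ofReal_one, mul_zero, mul_one, zero_add, add_zero]
  linear_combination (√(τ.im / π) * cexp (weightExp τ n p) * (π * I * n / τ.im) * Θ p *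
    p.1.im / 2) * I_sq

theorem eq_of_dt_eq_zero {Θ : ℂ × ℝ → ℂ} (hΘ : Differentiable ℝ Θ) (h : ∀ p, Heis.dt Θ p = 0)
    (z : ℂ) (t : ℝ) : Θ (z, t) = Θ (z, 0) := by
  have hd : ∀ t : ℝ, HasDerivAt (fun t => Θ (z, t)) 0 t := fun t => by
    have := (hΘ (z, t)).hasFDerivAt.comp_hasDerivAt t ((hasDerivAt_const t z).prodMk (hasDerivAt_id t))
    rwa [show fderiv ℝ Θ (z, t) (0, 1) = 0 from h (z, t)] at this
  exact is_const_of_deriv_eq_zero (fun t => (hd t).differentiableAt) (fun t => (hd t).deriv) t 0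

/-- The Cauchy–Riemann equation in the form `∂Θ/∂z̄ = 0`. -/
theorem differentiable_of_dzbar_eq_zero {Θ : ℂ × ℝ → ℂ} (hΘ : Differentiable ℝ Θ)
    (h : ∀ p, Heis.dzbar Θ p = 0) : Differentiable ℂ fun z => Θ (z, 0) := by
  intro z
  have hf : HasFDerivAt (fun z => Θ (z, 0)) (fderiv ℝ Θ (z, 0) ∘L .inl ℝ ℂ ℝ) z :=
    (hΘ (z, 0)).hasFDerivAt.comp z ((hasFDerivAt_id z).prodMk (hasFDerivAt_const (0 : ℝ) z))
  refine differentiableAt_complex_iff_differentiableAt_real.mpr ⟨hf.differentiableAt, ?_⟩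
  have h1 := h (z, 0)
  rw [Heis.dzbar] at h1
  rw [hf.fderiv]
  simp only [ContinuousLinearMap.comp_apply, ContinuousLinearMap.inl_apply, smul_eq_mul]
  linear_combination (-2 * I) * h1 + fderiv ℝ Θ (z, 0) (I, 0) * I_sq

theorem fderiv_comp_fst {θ : ℂ → ℂ} (hθ : Differentiable ℂ θ) (p v : ℂ × ℝ) :
    fderiv ℝ (fun p : ℂ × ℝ => θ p.1) p v = deriv θ p.1 * v.1 := by
  have h := ((hθ p.1).hasDerivAt.hasFDerivAt.restrictScalars ℝ).comp p
    (hasFDerivAt_fst (𝕜 := ℝ) (E := ℂ) (F := ℝ) (p := p))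
  have h' : fderiv ℝ (fun p : ℂ × ℝ => θ p.1) p = _ := h.fderiv
  rw [h']
  simp [mul_comm]

/-! ### Functions on the Heisenberg manifold -/

theorem proj_surjective (τ : ℂ) : Function.Surjective (M3.proj τ) := fun m => by
  induction m using QuotientGroup.induction_on with | H g => exact ⟨(g.z, g.t), rfl⟩

theorem pullback_injective (τ : ℂ) : Function.Injective (M3.pullback τ) :=
  (proj_surjective τ).injective_comp_right

theorem pullback_add_one (τ : ℂ) (f : M3 τ → ℂ) (z : ℂ) (t : ℝ) :
    M3.pullback τ f (z + 1, t - z.im) = M3.pullback τ f (z, t) := by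
  have h := QuotientGroup.mk_mul_of_mem (H3.mk z t)
    (Subgroup.subset_closure (Set.mem_insert (H3.mk 1 0) {⟨τ, 0⟩}))
  rw [H3.mul_def] at h
  rw [show t - z.im = t + 0 + (starRingEnd ℂ z * 1).im by simp [sub_eq_add_neg]]
  exact congrArg f h

theorem pullback_add_tau (τ : ℂ) (f : M3 τ → ℂ) (z : ℂ) (t : ℝ) :
    M3.pullback τ f (z + τ, t + (starRingEnd ℂ z * τ).im) = M3.pullback τ f (z, t) := by
  have h := QuotientGroup.mk_mul_of_mem (H3.mk z t)
    (Subgroup.subset_closure (Set.mem_insert_of_mem (H3.mk 1 0) (Set.mem_singleton (H3.mk τ 0))))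
  rw [H3.mul_def, add_zero] at h
  exact congrArg f h

/-- A function on `ℂ × ℝ` descends to `M₃` as soon as it is invariant under the two generators. -/
theorem exists_pullback_eq {τ : ℂ} {F : ℂ × ℝ → ℂ} (h1 : ∀ z t, F (z + 1, t - z.im) = F (z, t))
    (h2 : ∀ z t, F (z + τ, t + (starRingEnd ℂ z * τ).im) = F (z, t)) :
    ∃ f, M3.pullback τ f = F := by
  have key : ∀ h ∈ H3.intSubgroup τ, ∀ g : H3, F ((g * h).z, (g * h).t) = F (g.z, g.t) := by
    intro h hh
    induction hh using Subgroup.closure_induction with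
    | mem x hx =>
      intro g
      rcases hx with rfl | rfl
      · simpa [H3.mul_def, sub_eq_add_neg] using h1 g.z g.t
      · simpa [H3.mul_def] using h2 g.z g.t
    | one => simp
    | mul x y _ _ hx hy => intro g; rw [← mul_assoc, hy, hx]
    | inv x _ hx => intro g; rw [← hx (g * x⁻¹), inv_mul_cancel_right]
  refine ⟨Quotient.lift (fun g : H3 => F (g.z, g.t)) fun a b hab => ?_, rfl⟩
  have h := key _ (QuotientGroup.leftRel_apply.mp hab) a
  rw [mul_inv_cancel_left] at h
  exact h.symm

theorem weightExp_add_one (τ : ℂ) (n : ℤ) (z : ℂ) (t : ℝ) :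
    weightExp τ n (z + 1, t - z.im) = weightExp τ n (z, t) := by
  simp only [weightExp, add_im, one_im]
  push_cast
  ring

theorem weightExp_add_tau {τ : ℂ} (hτ : τ.im ≠ 0) (n : ℤ) (z : ℂ) (t : ℝ) :
    weightExp τ n (z + τ, t + (starRingEnd ℂ z * τ).im) =
      weightExp τ n (z, t) + π * I * n * (2 * z + τ) := by
  have h0 : (τ.im : ℂ) ≠ 0 := by exact_mod_cast hτ
  have hz : ((starRingEnd ℂ z * τ).im : ℂ) + τ * z.im = τ.im * z := by
    apply Complex.ext
    · simp
      ring
    · simp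
  simp only [weightExp, add_im]
  field_simp
  push_cast
  linear_combination (n : ℂ) * hz

/-- An element of `A_hol ∩ A_n` is `e^φ θ(z)` with `θ` a theta function of degree `n`; `θ(z)` is the
value of `e^{-φ} f` at `t = 0`. -/
theorem exists_isTheta {τ : ℂ} (hτ : 0 < τ.im) {n : ℤ} {f : M3 τ → ℂ}
    (hf : f ∈ M3.hol τ ∩ M3.weight τ n) :
    ∃ θ, IsTheta τ n θ ∧ M3.pullback τ f = fun p => cexp (weightExp τ n p) * θ p.1 := by
  obtain ⟨⟨hs, hq⟩, -, ht⟩ := hf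
  let Θ : ℂ × ℝ → ℂ := fun p => cexp (-weightExp τ n p) * M3.pullback τ f p
  have hF : M3.pullback τ f = fun p => cexp (weightExp τ n p) * Θ p := by
    funext p
    rw [← mul_assoc, ← Complex.exp_add, add_neg_cancel, Complex.exp_zero, one_mul]
  have hΘ : Differentiable ℝ Θ :=
    ((contDiff_weightExp τ n).neg.cexp.mul hs).differentiable (by simp)
  have hdt : ∀ p, Heis.dt Θ p = 0 := by
    intro p
    have h := ht p
    rw [hF, t_exp_weightExp_mul hτ.ne' n (hΘ p)] at h
    simpa [hτ.ne', pi_ne_zero] using h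
  have hdz : ∀ p, Heis.dzbar Θ p = 0 := by
    intro p
    have h := hq p
    rw [hF, q_exp_weightExp_mul τ n (hΘ p), hdt] at h
    have h0 : √(τ.im / π) ≠ 0 := (Real.sqrt_pos.mpr (by positivity)).ne'
    simpa only [mul_zero, sub_zero, mul_eq_zero, Complex.ofReal_eq_zero, h0, Complex.exp_ne_zero,
      false_or] using h
  have hc := eq_of_dt_eq_zero hΘ hdt
  have hF' : ∀ z t, M3.pullback τ f (z, t) = cexp (weightExp τ n (z, t)) * Θ (z, 0) := by
    intro z t
    rw [hF, ← hc z t]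
  refine ⟨fun z => Θ (z, 0), ⟨differentiable_of_dzbar_eq_zero hΘ hdz, fun z => ?_, fun z => ?_⟩,
    funext fun p => hF' p.1 p.2⟩
  · have h := pullback_add_one τ f z 0
    rw [hF', hF', weightExp_add_one] at h
    exact mul_left_cancel₀ (Complex.exp_ne_zero _) h
  · have h := pullback_add_tau τ f z 0
    rw [hF', hF', weightExp_add_tau hτ.ne', Complex.exp_add, mul_assoc] at h
    rw [Complex.exp_neg, ← mul_left_cancel₀ (Complex.exp_ne_zero _) h,
      inv_mul_cancel_left₀ (Complex.exp_ne_zero _)]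

/-- Conversely, `e^φ θ(z)` descends to an element of `A_hol ∩ A_n`. -/
theorem IsTheta.exists_mem {τ : ℂ} (hτ : 0 < τ.im) {n : ℤ} {θ : ℂ → ℂ} (hθ : IsTheta τ n θ) :
    ∃ f ∈ M3.hol τ ∩ M3.weight τ n,
      M3.pullback τ f = fun p => cexp (weightExp τ n p) * θ p.1 := by
  obtain ⟨f, hf⟩ := exists_pullback_eq (τ := τ)
    (F := fun p => cexp (weightExp τ n p) * θ p.1)
    (fun z t => by rw [weightExp_add_one, hθ.add_one])
    (fun z t => by
      rw [weightExp_add_tau hτ.ne', hθ.add_tau, Complex.exp_add, Complex.exp_neg, mul_assoc,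
        mul_inv_cancel_left₀ (Complex.exp_ne_zero _)])
  have hΘ : ContDiff ℝ ∞ fun p : ℂ × ℝ => θ p.1 :=
    ((hθ.differentiable.contDiff (n := ∞)).restrict_scalars ℝ).comp contDiff_fst
  have hs : f ∈ M3.smooth τ := by
    rw [M3.smooth, Set.mem_ofPred_eq, hf]
    exact (contDiff_weightExp τ n).cexp.mul hΘ
  have hd := hΘ.differentiable (by simp)
  have hdt : ∀ p, Heis.dt (fun p : ℂ × ℝ => θ p.1) p = 0 := fun p => by
    simp [Heis.dt, fderiv_comp_fst hθ.differentiable]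
  have hdz : ∀ p, Heis.dzbar (fun p : ℂ × ℝ => θ p.1) p = 0 := fun p => by
    rw [Heis.dzbar, fderiv_comp_fst hθ.differentiable, fderiv_comp_fst hθ.differentiable]
    linear_combination deriv θ p.1 / 2 * I_sq
  refine ⟨f, ⟨⟨hs, fun p => ?_⟩, hs, fun p => ?_⟩, hf⟩
  · rw [hf, q_exp_weightExp_mul τ n (hd p), hdt, hdz]; simp
  · rw [hf, t_exp_weightExp_mul hτ.ne' n (hd p), hdt]; simp

theorem weightExp_coords {τ : ℂ} (hτ : τ.im ≠ 0) (n : ℤ) (x y t : ℝ) :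
    weightExp τ n (x + τ * y, t) = π * I * n * (t / τ.im + x * y + τ * y ^ 2) := by
  have h0 : (τ.im : ℂ) ≠ 0 := by exact_mod_cast hτ
  simp only [weightExp, add_im, ofReal_im, im_mul_ofReal, zero_add]
  push_cast
  field_simp
  ring

end HeisTheta

theorem lemma5p3 (τ : ℂ) (hτ : 0 < τ.im) :
    (∀ n : ℤ, n < 0 → M3.hol τ ∩ M3.weight τ n = {0}) ∧
    (∀ n : ℕ, 0 < n →
      ∃ e : ↥(M3.hol τ ∩ M3.weight τ (n : ℤ)) ≃ (ZMod n → ℂ),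
        ∀ (f : ↥(M3.hol τ ∩ M3.weight τ (n : ℤ))) (x y t : ℝ),
          Summable (thetaTerm τ n (e f) (x + τ * y)) ∧
          f.1 (M3.proj τ (x + τ * y, t)) =
            Complex.exp (Real.pi * Complex.I * n *
              ((t : ℂ) / (τ.im : ℂ) + (x : ℂ) * (y : ℂ) + τ * (y : ℂ) ^ 2)) *
            ∑' k : ℤ, thetaTerm τ n (e f) (x + τ * y) k) := by
  open HeisTheta in
  refine ⟨fun n hn => Set.eq_singleton_iff_unique_mem.mpr ⟨?_, fun f hf => ?_⟩, fun n hn => ?_⟩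
  -- the zero function is a theta function of every degree
  · obtain ⟨f, hf, hf0⟩ := IsTheta.exists_mem hτ (n := n) (θ := 0)
      ⟨differentiable_const 0, fun z => rfl, fun z => by simp⟩
    rwa [show f = 0 from pullback_injective τ (hf0.trans (by ext p; simp [M3.pullback]))] at hf
  · obtain ⟨θ, hθ, hfθ⟩ := exists_isTheta hτ hf
    refine pullback_injective τ ?_
    rw [hfθ, hθ.eq_zero_of_neg hτ hn]
    ext p
    simp [M3.pullback]
  · choose g hg hgp using fun c => (isTheta_thetaSeries hτ hn c).exists_mem hτ
    have hbij : Function.Bijective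
        fun c => (⟨g c, hg c⟩ : ↥(M3.hol τ ∩ M3.weight τ (n : ℤ))) := by
      refine ⟨fun c d hcd => thetaSeries_injective hτ hn (funext fun z => ?_), fun f => ?_⟩
      · have h := congrFun (congrArg (M3.pullback τ) (Subtype.ext_iff.mp hcd)) (z, 0)
        rw [hgp, hgp] at h
        exact mul_left_cancel₀ (Complex.exp_ne_zero _) h
      · obtain ⟨θ, hθ, hfθ⟩ := exists_isTheta hτ f.2
        obtain ⟨c, rfl⟩ := hθ.exists_eq_thetaSeries hτ hn
        exact ⟨c, Subtype.ext (pullback_injective τ ((hgp c).trans hfθ.symm))⟩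
    refine ⟨(Equiv.ofBijective _ hbij).symm, fun f x y t => ⟨summable_thetaTerm hτ hn _ _, ?_⟩⟩
    obtain ⟨c, rfl⟩ := (Equiv.ofBijective _ hbij).surjective f
    rw [Equiv.symm_apply_apply]
    have h := congrFun (hgp c) (x + τ * y, t)
    rw [weightExp_coords hτ.ne'] at h
    exact_mod_cast h
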